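/- Let $D\subset\mathbb{R}^d$, $d\ge 1$, be a bounded domain (a nonempty connected open set) and $(\Omega,\mathcal F,\mathbb P)$ a probability space. Let $Y:=H^1_0(D)$, the closure of $C_c^\infty(D)$ in $H^1(D)$, with inner product $(u,v)_Y:=\int_D\nabla u\cdot\nabla v\,dx$, norm $\|u\|_Y=\|\nabla u\|_{L^2(D)}$ and dual $Y^\star=H^{-1}(D)$. Let $\alpha:\Omega\to C^0(\overline D)$, $\omega\mapsto\alpha(\cdot,\omega)$, be a (Borel) measurable random field that is almost surely positive on $\overline D$, and put $\alpha_{\min}(\omega):=\min_{x\in\overline D}\alpha(x,\omega)$, $\alpha_{\max}(\omega):=\max_{x\in\overline D}\alpha(x,\omega)$. Assume that, for some $p\in[2,\infty]$, both $\alpha_{\max}$ and $1/\alpha_{\min}$ lie in $L^p(\Omega)$. Write $a_\omega(v,w):=\int_D\alpha(x,\omega)\nabla v(x)\cdot\nabla w(x)\,dx$ for $v,w\in Y$, and let $\mathcal E$ be the energy space of all Borel measurable $v:\Omega\to Y$ with $\mathbb E[a_\omega(v_\omega,v_\omega)]<\infty$. For $\phi\in Y^\star$, a solution of the state equation with right-hand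 side $\phi$ is a $y\in\mathcal E$ such that $$\mathbb E[a_\omega(y_\omega,v_\omega)]=\mathbb E[\langle\phi,v_\omega\rangle]\qquad\text{for all }v\in\mathcal E .$$ Let $f\in Y^\star$, $y_d\in L^2(D)$, $\gamma\ge 0$ and $\beta>0$. Let the control space $U$ be either $L^2(D)$ or $Y$, and define $\Lambda_U:U\to Y^\star$ by $\langle\Lambda_U u,v\rangle:=(u,v)_U$ for $v\in Y$. Then, for either choice of $U$: 1. For every $u\in U$, the state equation with right-hand side $f+\Lambda_U u$ has a solution $y(u)$, which is unique up to $\mathbb P$-almost sure equality and lies in $L^2(\Omega,Y)$. 2. The robust optimal control problem $$\min_{u\in U}\;J(u):=\tfrac12\,\mathbb E\big[\|y_\omega(u)-y_d\|_{L^2(D)}^2\big]+\tfrac{\gamma}{2}\,\mathbb E\big[\|y_\omega(u)-\mathbb E[y_\omega(u)]\|_{L^2(D)}^2\big]+\tfrac{\beta}{2}\|u\|_U^2$$ has a unique solution $u^*\in U$. -/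

import Mathlib

open MeasureTheory
open scoped ENNReal

noncomputable section

namespace RobustOCP

/-- `ℝ^d` with its Euclidean norm. -/
abbrev Rd (d : ℕ) : Type := EuclideanSpace ℝ (Fin d)

/-- `L²(D)`. -/
abbrev L2 {d : ℕ} (D : Set (Rd d)) : Type := Lp ℝ 2 (volume.restrict D)

/-- `L²(D; ℝ^d)`. -/
abbrev L2vec {d : ℕ} (D : Set (Rd d)) : Type := Lp (Rd d) 2 (volume.restrict D)

/-- `L²(D) × L²(D; ℝ^d)` with the Hilbert norm `(‖u‖² + ‖g‖²)^{1/2}`. A function `u ∈ H¹(D)` is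
identified with the pair `(u, ∇u)`, whose norm in this space is the `H¹(D)` norm of `u`. -/
abbrev PairSpace {d : ℕ} (D : Set (Rd d)) : Type := WithLp 2 (L2 D × L2vec D)

/-- The pairs `(φ, ∇φ)` with `φ ∈ C_c^∞(D)`. -/
def testPairs {d : ℕ} (D : Set (Rd d)) : Set (PairSpace D) :=
  {w | ∃ φ : Rd d → ℝ, ContDiff ℝ (⊤ : ℕ∞) φ ∧ HasCompactSupport φ ∧ tsupport φ ⊆ D ∧
    w.fst =ᵐ[volume.restrict D] φ ∧ w.snd =ᵐ[volume.restrict D] gradient φ}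

/-- `H^1_0(D)`, the closure of `C_c^∞(D)` in the `H¹(D)` norm; an element `w` is a function
`w.fst ∈ L²(D)` together with its weak gradient `w.snd`. (The set of test pairs is already a linear
subspace, so that the span adds nothing.) -/
def H10 {d : ℕ} (D : Set (Rd d)) : Submodule ℝ (PairSpace D) :=
  (Submodule.span ℝ (testPairs D)).topologicalClosure

/-- `H^1_0(D)` carries its Borel σ-algebra. -/
instance instMeasurableSpaceH10 {d : ℕ} (D : Set (Rd d)) : MeasurableSpace (H10 D) := borel _

instance instBorelSpaceH10 {d : ℕ} (D : Set (Rd d)) : BorelSpace (H10 D) := ⟨rfl⟩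

/-- The embedding `H^1_0(D) → L²(D)`. -/
def toL2 {d : ℕ} (D : Set (Rd d)) : H10 D →L[ℝ] L2 D :=
  (WithLp.fstL 2 ℝ (L2 D) (L2vec D)).comp (H10 D).subtypeL

/-- The gradient `∇ : H^1_0(D) → L²(D; ℝ^d)`. -/
def grad {d : ℕ} (D : Set (Rd d)) : H10 D →L[ℝ] L2vec D :=
  (WithLp.sndL 2 ℝ (L2 D) (L2vec D)).comp (H10 D).subtypeL

/-- `Λ_{L²} : L²(D) → H^{-1}(D)`, `⟨Λ u, v⟩ = (u, v)_{L²(D)}`. -/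
def rieszL2 {d : ℕ} (D : Set (Rd d)) (u : L2 D) : StrongDual ℝ (H10 D) :=
  (innerSL ℝ u).comp (toL2 D)

/-- `Λ_Y : Y → Y^*` for `Y = H^1_0(D)` with the inner product `(u, v)_Y = ∫_D ∇u · ∇v`. -/
def rieszH10 {d : ℕ} (D : Set (Rd d)) (u : H10 D) : StrongDual ℝ (H10 D) :=
  (innerSL ℝ (grad D u)).comp (grad D)

/-- `∫_D c ∇u · ∇v dx` for a coefficient `c ∈ C⁰(closure D)`. (The value 0 of the extended
coefficient outside `closure D` plays no role, since one integrates over `D`.) -/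
def diffusionForm {d : ℕ} {D : Set (Rd d)} (c : C(closure D, ℝ)) (u v : H10 D) : ℝ :=
  ∫ x in D, Function.extend Subtype.val c 0 x * inner ℝ (grad D u x) (grad D v x)

/-- The assumption on the random diffusion field `α` with integrability exponent `p`: the map
`ω ↦ α ω ∈ C⁰(closure D)` is Borel measurable, almost every realization is positive on `closure D`,
and `α_max` and `1 / α_min` lie in `L^p(Ω)`. -/
structure DiffusionAssumption {d : ℕ} {D : Set (Rd d)} {Ω : Type*} [mΩ : MeasurableSpace Ω]
    (P : Measure Ω) (α : Ω → C(closure D, ℝ)) (p : ℝ≥0∞) : Prop where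
  measurable : @Measurable Ω C(closure D, ℝ) mΩ (borel _) α
  pos : ∀ᵐ ω ∂P, ∀ x, 0 < α ω x
  memLp_max : MemLp (fun ω => ⨆ x, α ω x) p P
  memLp_inv_min : MemLp (fun ω => 1 / ⨅ x, α ω x) p P

section OCP

variable {d : ℕ} {D : Set (Rd d)} {Ω : Type*} [MeasurableSpace Ω]

/-- The energy space: Borel measurable `v : Ω → H^1_0(D)` with
`a(v, v) = E[∫_D α |∇v|²] < ∞`. -/
def energySpace (P : Measure Ω) (α : Ω → C(closure D, ℝ)) : Set (Ω → H10 D) :=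
  {v | Measurable v ∧ Integrable (fun ω => diffusionForm (α ω) (v ω) (v ω)) P}

/-- `y` solves the state equation with right-hand side `φ ∈ H^{-1}(D)`: it lies in the energy space
and `E[∫_D α ∇y · ∇v] = E[⟨φ, v⟩]` for all `v` in the energy space. -/
def IsState (P : Measure Ω) (α : Ω → C(closure D, ℝ)) (φ : StrongDual ℝ (H10 D))
    (y : Ω → H10 D) : Prop :=
  y ∈ energySpace P α ∧ ∀ v ∈ energySpace P α,
    ∫ ω, diffusionForm (α ω) (y ω) (v ω) ∂P = ∫ ω, φ (v ω) ∂P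

/-- The state equation with right-hand side `φ` has a solution in `L²(Ω, H^1_0(D))`, and any two
solutions agree almost surely. -/
def HasUniqueL2State (P : Measure Ω) (α : Ω → C(closure D, ℝ))
    (φ : StrongDual ℝ (H10 D)) : Prop :=
  ∃ y, IsState P α φ y ∧ MemLp y 2 P ∧ ∀ y', IsState P α φ y' → y' =ᵐ[P] y

/-- The objective
`1/2 E[‖y - y_d‖²] + γ/2 E[‖y - E[y]‖²] + β/2 ‖u‖_U²` (norms of `L²(D)`), where `nsq = ‖u‖_U²`. -/
def objective (P : Measure Ω) (γ β : ℝ) (yd : L2 D) (y : Ω → H10 D) (nsq : ℝ) : ℝ :=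
  1 / 2 * ∫ ω, ‖toL2 D (y ω) - yd‖ ^ 2 ∂P
    + γ / 2 * ∫ ω, ‖toL2 D (y ω) - ∫ ω', toL2 D (y ω') ∂P‖ ^ 2 ∂P
    + β / 2 * nsq

/-- `u` solves the optimal control problem with control set `U`, where `Λ : U → H^{-1}(D)` maps a
control to the force it exerts and `nsq` is the squared norm of `U`: with its state `y`, it attains
the minimum of the objective over all controls `u'` and their states `y'`. -/
def IsOptimalControl (P : Measure Ω) (α : Ω → C(closure D, ℝ)) (γ β : ℝ) (yd : L2 D)
    (f : StrongDual ℝ (H10 D)) {U : Type*} (Λ : U → StrongDual ℝ (H10 D)) (nsq : U → ℝ)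
    (u : U) : Prop :=
  ∃ y, IsState P α (f + Λ u) y ∧ ∀ u' y', IsState P α (f + Λ u') y' →
    objective P γ β yd y (nsq u) ≤ objective P γ β yd y' (nsq u')

end OCP

end RobustOCP

end

/-!
The argument splits into the state equation, solved realization by realization, and a minimization
over a complete space of a continuous, uniformly convex objective.

*State equation.* Integrating `∂ᵥ(⟨v, x⟩ φ²)` over the space gives the Poincaré inequality on the
bounded set `D`, so that `‖∇u‖` controls the `H¹` norm on `H^1_0(D)`. Hence, for a coefficient
`c ≥ m > 0`, the operator `energyOp D c` representing `∫_D c ∇u · ∇v` is coercive and therefore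
invertible, and its inverse `solutionOp D c` satisfies `‖y‖ ≤ K ‖φ‖ / m`. The operator depends
continuously on `c ∈ C⁰(closure D)` and inversion is continuous on the open set of units, which
makes `ω ↦ solutionOp D (α ω) b` measurable (`measurable_solutionOp_apply`). The bound and
`1 / α_min ∈ L²(Ω)` put this pathwise solution into `L²(Ω, H^1_0(D))`, and testing with it shows
that its energy is finite. Two solutions have a difference of finite energy, by Cauchy-Schwarz for the
energy form; used as a test function it shows that the difference vanishes almost surely
(`EllipticityBound.ae_eq_of_isState`).

*Optimal control.* The state is a bounded affine function of the control with values in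
`L²(Ω, L²(D))`, and the objective is a sum of squared norms of affine functions, the last of which
controls the norm of the control. By the parallelogram law its value at a midpoint lies below the
mean of the values by at least a multiple of the squared distance. Minimizing sequences are
therefore Cauchy, and the minimizer is unique (`existsUnique_forall_le_of_midpoint_le`).
-/

noncomputable section

namespace RobustOCP

variable {d : ℕ} {D : Set (Rd d)}

/-! ### The Poincaré inequality on `H^1_0(D)` -/

theorem sq_norm_L2_eq_integral {X E : Type*} [MeasurableSpace X] {μ : Measure X}
    [NormedAddCommGroup E] [InnerProductSpace ℝ E] (f : Lp E 2 μ) :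
    ‖f‖ ^ 2 = ∫ x, ‖f x‖ ^ 2 ∂μ := by
  rw [← real_inner_self_eq_norm_sq, L2.inner_def]
  simp

/-- Poincaré inequality for a test function `φ` supported in a ball of radius `R`: integration by
parts of `φ² = φ² ∂ᵥ⟨v, x⟩` moves the derivative to `φ²`. -/
theorem integral_sq_le_integral_sq_norm_gradient {E : Type*} [NormedAddCommGroup E]
    [InnerProductSpace ℝ E] [FiniteDimensional ℝ E] [MeasurableSpace E] [BorelSpace E]
    {v : E} (hv : ‖v‖ = 1) {R : ℝ} {φ : E → ℝ}
    (hφ : ContDiff ℝ (⊤ : ℕ∞) φ) (hc : HasCompactSupport φ) (hR : ∀ x ∈ tsupport φ, ‖x‖ ≤ R) :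
    ∫ x, φ x ^ 2 ≤ 4 * R ^ 2 * ∫ x, ‖gradient φ x‖ ^ 2 := by
  have hd1 : Differentiable ℝ φ := hφ.differentiable (by simp)
  have hcφ : Continuous φ := hφ.continuous
  have hcd : Continuous (fun x => fderiv ℝ φ x v) :=
    (hφ.continuous_fderiv (by simp)).clm_apply continuous_const
  have hcg : Continuous (gradient φ) :=
    (InnerProductSpace.toDual ℝ E).symm.continuous.comp (hφ.continuous_fderiv (by simp))
  have hgc : HasCompactSupport (gradient φ) :=
    HasCompactSupport.comp_left (g := (InnerProductSpace.toDual ℝ E).symm)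
      (hc.fderiv ℝ) (map_zero _)
  have hder : ∀ x, fderiv ℝ (fun x => φ x ^ 2) x v = 2 * φ x * fderiv ℝ φ x v := by
    intro x
    rw [((hd1 x).hasFDerivAt.pow 2).fderiv]
    simp
  have hi2 : Integrable (fun x => φ x ^ 2) :=
    Continuous.integrable_of_hasCompactSupport (hcφ.pow 2)
      (hc.mono fun x hx h0 => hx (by simp [h0]))
  have hig : Integrable (fun x => ‖gradient φ x‖ ^ 2) :=
    Continuous.integrable_of_hasCompactSupport (hcg.norm.pow 2)
      (hgc.mono fun x hx h0 => hx (by simp [h0]))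
  have hi3 : Integrable (fun x => fderiv ℝ (fun x => φ x ^ 2) x v * inner ℝ v x) := by
    simp_rw [hder]
    exact Continuous.integrable_of_hasCompactSupport (by fun_prop)
      (hc.mono fun x hx h0 => hx (by simp [h0]))
  have hi4 : Integrable (fun x => φ x ^ 2 * inner ℝ v x) :=
    Continuous.integrable_of_hasCompactSupport (by fun_prop)
      (hc.mono fun x hx h0 => hx (by simp [h0]))
  have hlin : ∀ x, fderiv ℝ (fun x : E => inner ℝ v x) x v = 1 := by
    intro x
    have h : HasFDerivAt (fun x : E => inner ℝ v x) (innerSL ℝ v) x :=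
      (innerSL ℝ v).hasFDerivAt
    rw [h.fderiv]
    simp [hv]
  have key := integral_mul_fderiv_eq_neg_fderiv_mul_of_integrable (μ := volume) (𝕜 := ℝ) (v := v)
    (f := fun x : E => φ x ^ 2) (g := fun x => inner ℝ v x) hi3
    (by simpa only [hlin, mul_one] using hi2) hi4 (fun x _ => (hd1 x).pow 2)
    (fun x _ => (innerSL ℝ v).differentiableAt)
  simp only [hlin, mul_one] at key
  have hle : ∫ x, φ x ^ 2 ≤ ∫ x, (1 / 2 * φ x ^ 2 + 2 * R ^ 2 * ‖gradient φ x‖ ^ 2) := by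
    rw [key, ← integral_neg]
    refine integral_mono hi3.neg ((hi2.const_mul _).add (hig.const_mul _)) fun x => ?_
    simp only [hder]
    by_cases hx : x ∈ tsupport φ
    · have h1 : |inner ℝ v x| ≤ R := by
        have := abs_real_inner_le_norm v x
        rw [hv, one_mul] at this
        exact this.trans (hR x hx)
      have h2 : |fderiv ℝ φ x v| ≤ ‖gradient φ x‖ := by
        have h : fderiv ℝ φ x v = inner ℝ (gradient φ x) v := by
          rw [gradient, InnerProductSpace.toDual_symm_apply]
        have := abs_real_inner_le_norm (gradient φ x) v
        rwa [hv, mul_one, ← h] at this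
      have h3 : |inner ℝ v x * fderiv ℝ φ x v| ≤ R * ‖gradient φ x‖ := by
        rw [abs_mul]; exact mul_le_mul h1 h2 (abs_nonneg _) ((abs_nonneg _).trans h1)
      have h4 : (inner ℝ v x * fderiv ℝ φ x v) ^ 2 ≤ (R * ‖gradient φ x‖) ^ 2 :=
        sq_le_sq' (abs_le.1 h3).1 (abs_le.1 h3).2
      -- Young's inequality `-2 φ s ≤ φ² / 2 + 2 s²` for `s = ⟨v, x⟩ ∂ᵥφ`; the first term is
      -- absorbed into the left-hand side.
      have h5 := sq_nonneg (φ x + 2 * (inner ℝ v x * fderiv ℝ φ x v))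
      linarith
    · have h0 : φ x = 0 := image_eq_zero_of_notMem_tsupport hx
      rw [h0]
      have : 0 ≤ 2 * R ^ 2 * ‖gradient φ x‖ ^ 2 := by positivity
      linarith
  rw [integral_add (hi2.const_mul _) (hig.const_mul _), integral_const_mul,
    integral_const_mul] at hle
  linarith

theorem norm_fst_le_of_mem_testPairs (hd : 1 ≤ d) {R : ℝ} (hR0 : 0 ≤ R)
    (hR : ∀ x ∈ D, ‖x‖ ≤ R) {w : PairSpace D} (hw : w ∈ testPairs D) :
    ‖w.fst‖ ≤ 2 * R * ‖w.snd‖ := by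
  obtain ⟨φ, hφ, hc, hs, h1, h2⟩ := hw
  have e1 : ‖w.fst‖ ^ 2 = ∫ x, φ x ^ 2 := by
    refine (sq_norm_L2_eq_integral _).trans (Eq.trans (integral_congr_ae ?_)
      (setIntegral_eq_integral_of_forall_compl_eq_zero (s := D) fun x hx => ?_))
    · filter_upwards [h1] with x hx
      simp [hx]
    · simp [image_eq_zero_of_notMem_tsupport fun h => hx (hs h)]
  have e2 : ‖w.snd‖ ^ 2 = ∫ x, ‖gradient φ x‖ ^ 2 := by
    refine (sq_norm_L2_eq_integral _).trans (Eq.trans (integral_congr_ae ?_)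
      (setIntegral_eq_integral_of_forall_compl_eq_zero (s := D) fun x hx => ?_))
    · filter_upwards [h2] with x hx
      simp [hx]
    · have : fderiv ℝ φ x = 0 := image_eq_zero_of_notMem_tsupport
        fun h => hx (hs (tsupport_fderiv_subset ℝ h))
      simp [gradient, this]
  have := integral_sq_le_integral_sq_norm_gradient (v := EuclideanSpace.single (⟨0, hd⟩ : Fin d) 1)
    (by simp) hφ hc fun x hx => hR x (hs hx)
  rw [← e1, ← e2] at this
  refine abs_le_of_sq_le_sq' (b := 2 * R * ‖w.snd‖) ?_ (by positivity) |>.2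
  linarith

theorem mem_testPairs_of_mem_span {w : PairSpace D}
    (hw : w ∈ Submodule.span ℝ (testPairs D)) : w ∈ testPairs D := by
  have hdiff {φ : Rd d → ℝ} (hφ : ContDiff ℝ (⊤ : ℕ∞) φ) : Differentiable ℝ φ :=
    hφ.differentiable (by simp)
  induction hw using Submodule.span_induction with
  | mem x h => exact h
  | zero =>
    refine ⟨0, contDiff_const, HasCompactSupport.zero, by simp [tsupport], Lp.coeFn_zero _ _ _, ?_⟩
    have : gradient (0 : Rd d → ℝ) = 0 := by ext1 x; simp [gradient]
    rw [this]
    exact Lp.coeFn_zero _ _ _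
  | add x y _ _ hx hy =>
    obtain ⟨φ, hφ, hc, hs, h1, h2⟩ := hx
    obtain ⟨ψ, hψ, hc', hs', h1', h2'⟩ := hy
    refine ⟨φ + ψ, hφ.add hψ, hc.add hc',
      (tsupport_add φ ψ).trans (Set.union_subset hs hs'), ?_, ?_⟩
    · exact (Lp.coeFn_add _ _).trans (h1.add h1')
    · have : gradient (φ + ψ) = gradient φ + gradient ψ := by
        ext1 x
        simp [gradient, fderiv_add (hdiff hφ x) (hdiff hψ x)]
      rw [this]
      exact (Lp.coeFn_add _ _).trans (h2.add h2')
  | smul a x _ hx =>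
    obtain ⟨φ, hφ, hc, hs, h1, h2⟩ := hx
    refine ⟨a • φ, hφ.const_smul a, hc.smul_left (f := fun _ => a),
      (tsupport_smul_subset_right (fun _ => a) φ).trans hs, ?_, ?_⟩
    · exact (Lp.coeFn_smul _ _).trans (h1.const_smul a)
    · have : gradient (a • φ) = a • gradient φ := by
        ext1 x
        simp [gradient, fderiv_const_smul (hdiff hφ x)]
      rw [this]
      exact (Lp.coeFn_smul _ _).trans (h2.const_smul a)

theorem norm_toL2_le (hd : 1 ≤ d) {R : ℝ} (hR0 : 0 ≤ R) (hR : ∀ x ∈ D, ‖x‖ ≤ R) (u : H10 D) :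
    ‖toL2 D u‖ ≤ 2 * R * ‖grad D u‖ := by
  have hcl : IsClosed {w : PairSpace D | ‖w.fst‖ ≤ 2 * R * ‖w.snd‖} :=
    isClosed_le ((WithLp.fstL 2 ℝ (L2 D) (L2vec D)).continuous.norm)
      (continuous_const.mul (WithLp.sndL 2 ℝ (L2 D) (L2vec D)).continuous.norm)
  exact closure_minimal
    (fun _ hw => norm_fst_le_of_mem_testPairs hd hR0 hR (mem_testPairs_of_mem_span hw))
    hcl u.2

theorem exists_sq_norm_le_sq_norm_grad (hd : 1 ≤ d) (hD : Bornology.IsBounded D) :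
    ∃ K : ℝ, 0 < K ∧ ∀ u : H10 D, ‖u‖ ^ 2 ≤ K * ‖grad D u‖ ^ 2 := by
  obtain ⟨R, hR0, hR⟩ := hD.exists_pos_norm_le
  refine ⟨4 * R ^ 2 + 1, by positivity, fun u => ?_⟩
  have h1 : ‖u‖ ^ 2 = ‖toL2 D u‖ ^ 2 + ‖grad D u‖ ^ 2 :=
    WithLp.prod_norm_sq_eq_of_L2 (u : PairSpace D)
  have h2 := norm_toL2_le hd hR0.le hR u
  have h3 := pow_le_pow_left₀ (norm_nonneg _) h2 2
  nlinarith

/-! ### Completeness and separability of `H^1_0(D)` -/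

instance : CompleteSpace (H10 D) :=
  (Submodule.isClosed_topologicalClosure _).completeSpace_coe

instance : SecondCountableTopology (H10 D) :=
  haveI : Fact ((2 : ℝ≥0∞) ≠ ∞) := ⟨ENNReal.ofNat_ne_top⟩
  haveI : SecondCountableTopology (L2 D) := Lp.SecondCountableTopology
  haveI : SecondCountableTopology (L2vec D) := Lp.SecondCountableTopology
  haveI : SecondCountableTopology (PairSpace D) := WithLp.secondCountableTopology 2 _ _
  TopologicalSpace.Subtype.secondCountableTopology (H10 D : Set (PairSpace D))

/-! ### The operator of the energy form -/

theorem measurable_extend_coeff (c : C(closure D, ℝ)) :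
    Measurable (Function.extend Subtype.val c (0 : Rd d → ℝ)) :=
  (MeasurableEmbedding.subtype_coe isClosed_closure.measurableSet).measurable_extend
    c.continuous.measurable measurable_const

theorem norm_extend_coeff_le [CompactSpace (closure D)] (c : C(closure D, ℝ)) (x : Rd d) :
    ‖Function.extend Subtype.val c (0 : Rd d → ℝ) x‖ ≤ ‖c‖ := by
  by_cases hx : x ∈ closure D
  · have := Subtype.val_injective.extend_apply c (0 : Rd d → ℝ) (⟨x, hx⟩ : closure D)
    exact this ▸ c.norm_coe_le_norm _
  · rw [Function.extend_apply' _ _ _ fun ⟨a, ha⟩ => hx (ha ▸ a.2)]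
    simp

theorem memLp_top_extend_coeff [CompactSpace (closure D)] (c : C(closure D, ℝ)) :
    MemLp (Function.extend Subtype.val c (0 : Rd d → ℝ)) ∞ (volume.restrict D) :=
  memLp_top_of_bound (measurable_extend_coeff c).aestronglyMeasurable ‖c‖
    (ae_of_all _ (norm_extend_coeff_le c))

variable (D) in
/-- The multiplier in `L^∞(D)` given by a continuous coefficient, as a bounded linear map. -/
def coeffLp [CompactSpace (closure D)] :
    C(closure D, ℝ) →L[ℝ] Lp ℝ ∞ (volume.restrict D) :=
  LinearMap.mkContinuous
    { toFun := fun c => (memLp_top_extend_coeff c).toLp _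
      map_add' := fun c c' => by
        rw [← MemLp.toLp_add]
        congr 1
        rw [← Function.extend_add]
        simp
      map_smul' := fun a c => by
        rw [RingHom.id_apply, ← MemLp.toLp_const_smul]
        congr 1
        rw [← Function.extend_smul]
        simp } 1 fun c => by
    rw [one_mul]
    change ‖(memLp_top_extend_coeff c).toLp _‖ ≤ ‖c‖
    rw [Lp.norm_toLp]
    refine ENNReal.toReal_le_of_le_ofReal (norm_nonneg _) ?_
    simpa using eLpNorm_le_of_ae_bound (p := ∞) (μ := volume.restrict D)
      (ae_of_all _ (norm_extend_coeff_le c))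

theorem coeffLp_coeFn [CompactSpace (closure D)] (c : C(closure D, ℝ)) :
    coeffLp D c =ᵐ[volume.restrict D] Function.extend Subtype.val c (0 : Rd d → ℝ) :=
  MemLp.coeFn_toLp (memLp_top_extend_coeff c)

variable (D) in
/-- The operator on `H^1_0(D)` that represents the form `∫_D c ∇u · ∇v` with respect to the `H¹`
inner product, as a bounded linear function of `c`: the composition `∇* c ∇`. -/
def energyOp [CompactSpace (closure D)] : C(closure D, ℝ) →L[ℝ] (H10 D →L[ℝ] H10 D) :=
  (ContinuousLinearMap.postcomp (H10 D) (ContinuousLinearMap.adjoint (grad D))).comp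
    ((ContinuousLinearMap.precomp (L2vec D) (grad D)).comp
      (((ContinuousLinearMap.lsmul ℝ ℝ).holderL (volume.restrict D) ∞ 2 2).comp (coeffLp D)))

theorem inner_energyOp [CompactSpace (closure D)] (c : C(closure D, ℝ)) (u v : H10 D) :
    inner ℝ (energyOp D c u) v = diffusionForm c u v := by
  change inner ℝ (ContinuousLinearMap.adjoint (grad D)
    ((ContinuousLinearMap.lsmul ℝ ℝ).holder 2 (coeffLp D c) (grad D u))) v = _
  rw [ContinuousLinearMap.adjoint_inner_left, L2.inner_def, diffusionForm]
  refine integral_congr_ae ?_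
  filter_upwards [ContinuousLinearMap.coeFn_holder (r := 2) (ContinuousLinearMap.lsmul ℝ ℝ)
    (coeffLp D c) (grad D u), coeffLp_coeFn c] with x h1 h2
  rw [h1, h2]
  simp [inner_smul_left]

theorem mul_sq_norm_grad_le_diffusionForm [CompactSpace (closure D)] (hD : MeasurableSet D)
    {c : C(closure D, ℝ)} {m : ℝ} (hm : ∀ x, m ≤ c x) (u : H10 D) :
    m * ‖grad D u‖ ^ 2 ≤ diffusionForm c u u := by
  have hi : Integrable (fun x => ‖grad D u x‖ ^ 2) (volume.restrict D) :=
    (Lp.memLp (grad D u)).integrable_norm_pow two_ne_zero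
  rw [sq_norm_L2_eq_integral, ← integral_const_mul, diffusionForm]
  simp only [real_inner_self_eq_norm_sq]
  refine integral_mono_ae (hi.const_mul m) ?_ ?_
  · refine hi.bdd_mul (c := ‖c‖) (measurable_extend_coeff c).aestronglyMeasurable
      (ae_of_all _ (norm_extend_coeff_le c))
  · filter_upwards [ae_restrict_mem hD] with x hx
    have := Subtype.val_injective.extend_apply c (0 : Rd d → ℝ) (⟨x, subset_closure hx⟩ : closure D)
    exact mul_le_mul_of_nonneg_right (this ▸ hm _) (sq_nonneg _)

/-! ### The solution operator for a fixed coefficient -/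

variable (D) in
/-- The inverse of `energyOp D c`, with the junk value `0` if `energyOp D c` is not invertible. -/
def solutionOp [CompactSpace (closure D)] (c : C(closure D, ℝ)) : H10 D →L[ℝ] H10 D :=
  Ring.inverse (energyOp D c)

/-- Lax-Milgram: a coefficient bounded below by a positive constant gives an invertible operator. -/
theorem isUnit_energyOp [CompactSpace (closure D)] {K : ℝ} (hK : 0 < K)
    (hKu : ∀ u : H10 D, ‖u‖ ^ 2 ≤ K * ‖grad D u‖ ^ 2) (hD : MeasurableSet D)
    {c : C(closure D, ℝ)} {m : ℝ} (hm0 : 0 < m) (hm : ∀ x, m ≤ c x) :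
    IsUnit (energyOp D c) := by
  refine ContinuousLinearMap.isUnit_of_forall_le_norm_inner_map _
    (c := ⟨m / K, by positivity⟩) (show 0 < m / K by positivity) fun u => ?_
  rw [inner_energyOp]
  refine le_trans ?_ (le_abs_self _)
  refine le_trans ?_ (mul_sq_norm_grad_le_diffusionForm hD hm u)
  change ‖u‖ ^ 2 * (m / K) ≤ _
  have := mul_le_mul_of_nonneg_left (hKu u) (show 0 ≤ m / K by positivity)
  calc _ ≤ m / K * (K * ‖grad D u‖ ^ 2) := by linarith
    _ = _ := by field_simp

theorem diffusionForm_solutionOp [CompactSpace (closure D)] {c : C(closure D, ℝ)}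
    (hc : IsUnit (energyOp D c)) (b v : H10 D) :
    diffusionForm c (solutionOp D c b) v = inner ℝ b v := by
  rw [← inner_energyOp, solutionOp]
  change inner ℝ ((energyOp D c * Ring.inverse (energyOp D c)) b) v = _
  rw [Ring.mul_inverse_cancel _ hc]
  rfl

theorem norm_solutionOp_le [CompactSpace (closure D)] {K : ℝ} (hK : 0 < K)
    (hKu : ∀ u : H10 D, ‖u‖ ^ 2 ≤ K * ‖grad D u‖ ^ 2) (hD : MeasurableSet D)
    {c : C(closure D, ℝ)} {m : ℝ} (hm0 : 0 < m) (hm : ∀ x, m ≤ c x) (b : H10 D) :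
    ‖solutionOp D c b‖ ≤ K * ‖b‖ * (1 / m) := by
  set y := solutionOp D c b with hy
  have h1 := mul_sq_norm_grad_le_diffusionForm hD hm y
  rw [hy, diffusionForm_solutionOp (isUnit_energyOp hK hKu hD hm0 hm), ← hy] at h1
  have h2 := h1.trans (real_inner_le_norm b y)
  have h3 : m * ‖y‖ ^ 2 ≤ K * (‖b‖ * ‖y‖) :=
    calc m * ‖y‖ ^ 2 ≤ m * (K * ‖grad D y‖ ^ 2) := by gcongr; exact hKu y
      _ = K * (m * ‖grad D y‖ ^ 2) := by ring
      _ ≤ _ := by gcongr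
  rw [mul_one_div, le_div_iff₀ hm0]
  rcases (norm_nonneg y).eq_or_lt with h0 | h0
  · rw [← h0]; simp; positivity
  · exact le_of_mul_le_mul_right (by linarith) h0

/-! ### Measurable dependence on the coefficient -/

/-- Inversion is continuous on the open set of coefficients with invertible operator, and
`solutionOp` is `0` on its complement. -/
theorem measurable_solutionOp_apply [CompactSpace (closure D)] [MeasurableSpace C(closure D, ℝ)]
    [BorelSpace C(closure D, ℝ)] (b : H10 D) :
    Measurable fun c : C(closure D, ℝ) => solutionOp D c b := by
  classical
  let s : Set C(closure D, ℝ) := {c | IsUnit (energyOp D c)}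
  have hu : IsOpen {T : H10 D →L[ℝ] H10 D | IsUnit T} :=
    Units.isOpen (R := H10 D →L[ℝ] H10 D)
  have hs : IsOpen s := hu.preimage (energyOp D).continuous
  have h : (fun c => solutionOp D c b) = s.piecewise (fun c => solutionOp D c b) 0 := by
    ext1 c
    by_cases hc : c ∈ s
    · simp [hc]
    · rw [Set.piecewise_eq_of_notMem _ _ _ hc, solutionOp, Ring.inverse_non_unit _ hc]
      rfl
  rw [h]
  refine ContinuousOn.measurable_piecewise (fun c hc => ?_) continuousOn_const hs.measurableSet
  obtain ⟨a, ha⟩ : IsUnit (energyOp D c) := hc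
  have h1 : ContinuousAt (fun c => solutionOp D c) c :=
    ContinuousAt.comp (g := Ring.inverse) (f := energyOp D)
      (ha ▸ NormedRing.inverse_continuousAt (R := H10 D →L[ℝ] H10 D) a)
      (energyOp D).continuous.continuousAt
  exact (h1.clm_apply continuousAt_const).continuousWithinAt

theorem measurable_inner_energyOp [CompactSpace (closure D)] [MeasurableSpace C(closure D, ℝ)]
    [BorelSpace C(closure D, ℝ)] :
    Measurable fun q : C(closure D, ℝ) × H10 D × H10 D => inner ℝ (energyOp D q.1 q.2.1) q.2.2 := by
  have hc : Continuous fun q : C(closure D, ℝ) × H10 D × H10 D =>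
      inner ℝ (energyOp D q.1 q.2.1) q.2.2 :=
    (((energyOp D).continuous.comp continuous_fst).clm_apply
      (continuous_fst.comp continuous_snd)).inner (continuous_snd.comp continuous_snd)
  exact hc.measurable

theorem measurable_diffusionForm [CompactSpace (closure D)] [MeasurableSpace C(closure D, ℝ)]
    [BorelSpace C(closure D, ℝ)] {Ω : Type*} [MeasurableSpace Ω]
    {α : Ω → C(closure D, ℝ)} (hα : Measurable α)
    {u v : Ω → H10 D} (hu : Measurable u) (hv : Measurable v) :
    Measurable fun ω => diffusionForm (α ω) (u ω) (v ω) := by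
  have h := (measurable_inner_energyOp (D := D)).comp (hα.prodMk (hu.prodMk hv))
  exact (funext fun ω => (inner_energyOp (α ω) (u ω) (v ω)).symm) ▸ h

/-! ### Algebra of the energy form -/

theorem diffusionForm_comm (c : C(closure D, ℝ)) (u v : H10 D) :
    diffusionForm c u v = diffusionForm c v u := by
  unfold diffusionForm
  congr 1 with x
  rw [real_inner_comm]

theorem diffusionForm_sub_self [CompactSpace (closure D)] (c : C(closure D, ℝ)) (u v : H10 D) :
    diffusionForm c (u - v) (u - v) =
      diffusionForm c u u - 2 * diffusionForm c u v + diffusionForm c v v := by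
  have h := diffusionForm_comm c u v
  simp only [← inner_energyOp] at h ⊢
  rw [map_sub, inner_sub_left, inner_sub_right, inner_sub_right]
  linarith

/-- The Cauchy-Schwarz inequality for the energy form, in its additive form. -/
theorem two_mul_abs_diffusionForm_le [CompactSpace (closure D)] (hD : MeasurableSet D)
    {c : C(closure D, ℝ)} (hc : ∀ x, 0 ≤ c x) (u v : H10 D) :
    2 * |diffusionForm c u v| ≤ diffusionForm c u u + diffusionForm c v v := by
  have hnn (w : H10 D) : 0 ≤ diffusionForm c w w := by
    simpa using mul_sq_norm_grad_le_diffusionForm hD hc w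
  have h1 := hnn (u - v)
  have h2 := hnn (u - -v)
  rw [diffusionForm_sub_self] at h1 h2
  have h3 : diffusionForm c u (-v) = - diffusionForm c u v := by
    simp only [← inner_energyOp, inner_neg_right]
  have h4 : diffusionForm c (-v) (-v) = diffusionForm c v v := by
    simp only [← inner_energyOp, map_neg, inner_neg_neg]
  rw [h3, h4] at h2
  have := abs_le.2 (⟨by linarith, by linarith⟩ :
    -((diffusionForm c u u + diffusionForm c v v) / 2) ≤ diffusionForm c u v ∧
      diffusionForm c u v ≤ (diffusionForm c u u + diffusionForm c v v) / 2)
  linarith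

/-! ### The random state equation -/

variable {Ω : Type*} [MeasurableSpace Ω]

/-- The pathwise solution of the state equation with right-hand side `φ`. -/
def state [CompactSpace (closure D)] (α : Ω → C(closure D, ℝ)) (φ : StrongDual ℝ (H10 D))
    (ω : Ω) : H10 D :=
  solutionOp D (α ω) ((InnerProductSpace.toDual ℝ (H10 D)).symm φ)

/-- Measurability of the random coefficient, with a lower bound `m` whose reciprocal is square
integrable, together with the Poincaré inequality on `D` with constant `K`. -/
structure EllipticityBound (P : Measure Ω) (α : Ω → C(closure D, ℝ)) (m : Ω → ℝ) (K : ℝ) :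
    Prop where
  measurable : @Measurable _ _ _ (borel _) α
  measurableSet : MeasurableSet D
  pos : 0 < K
  poincare : ∀ u : H10 D, ‖u‖ ^ 2 ≤ K * ‖grad D u‖ ^ 2
  lower : ∀ᵐ ω ∂P, 0 < m ω ∧ ∀ x, m ω ≤ α ω x
  memLp : MemLp (fun ω => 1 / m ω) 2 P

namespace EllipticityBound

variable [CompactSpace (closure D)] {P : Measure Ω} {α : Ω → C(closure D, ℝ)} {m : Ω → ℝ} {K : ℝ}

theorem measurable_diffusionForm (h : EllipticityBound P α m K) {u v : Ω → H10 D}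
    (hu : Measurable u) (hv : Measurable v) :
    Measurable fun ω => diffusionForm (α ω) (u ω) (v ω) := by
  let _ : MeasurableSpace C(closure D, ℝ) := borel _
  have : BorelSpace C(closure D, ℝ) := ⟨rfl⟩
  exact RobustOCP.measurable_diffusionForm h.measurable hu hv

theorem measurable_state (h : EllipticityBound P α m K) (φ : StrongDual ℝ (H10 D)) :
    Measurable (state α φ) := by
  let _ : MeasurableSpace C(closure D, ℝ) := borel _
  have : BorelSpace C(closure D, ℝ) := ⟨rfl⟩
  exact (measurable_solutionOp_apply _).comp h.measurable

theorem diffusionForm_state (h : EllipticityBound P α m K) (φ : StrongDual ℝ (H10 D)) :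
    ∀ᵐ ω ∂P, ∀ v, diffusionForm (α ω) (state α φ ω) v = φ v := by
  filter_upwards [h.lower] with ω hω v
  rw [state, diffusionForm_solutionOp
    (isUnit_energyOp h.pos h.poincare h.measurableSet hω.1 hω.2),
    InnerProductSpace.toDual_symm_apply]

theorem norm_state_le (h : EllipticityBound P α m K) (φ : StrongDual ℝ (H10 D)) :
    ∀ᵐ ω ∂P, ‖state α φ ω‖ ≤ K * ‖φ‖ * ‖1 / m ω‖ := by
  filter_upwards [h.lower] with ω hω
  have := norm_solutionOp_le h.pos h.poincare h.measurableSet hω.1 hω.2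
    ((InnerProductSpace.toDual ℝ (H10 D)).symm φ)
  rw [LinearIsometryEquiv.norm_map] at this
  exact this.trans_eq (by rw [Real.norm_of_nonneg (one_div_pos.2 hω.1).le])

theorem memLp_state (h : EllipticityBound P α m K) (φ : StrongDual ℝ (H10 D)) :
    MemLp (state α φ) 2 P :=
  h.memLp.of_le_mul (h.measurable_state φ).aestronglyMeasurable (h.norm_state_le φ)

/-- The pathwise equation gives the equation in the mean because both integrands agree
almost surely. -/
theorem isState_state [IsProbabilityMeasure P] (h : EllipticityBound P α m K)
    (φ : StrongDual ℝ (H10 D)) : IsState P α φ (state α φ) := by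
  have hy := h.measurable_state φ
  refine ⟨⟨hy, ?_⟩, fun v _ => integral_congr_ae ?_⟩
  · have h1 : Integrable (fun ω => φ (state α φ ω)) P :=
      φ.integrable_comp ((h.memLp_state φ).integrable one_le_two)
    refine h1.congr ?_
    filter_upwards [h.diffusionForm_state φ] with ω hω using (hω _).symm
  · filter_upwards [h.diffusionForm_state φ] with ω hω using hω _

theorem integrable_diffusionForm (h : EllipticityBound P α m K) {u v : Ω → H10 D}
    (hu : u ∈ energySpace P α) (hv : v ∈ energySpace P α) :
    Integrable (fun ω => diffusionForm (α ω) (u ω) (v ω)) P := by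
  refine (hu.2.add hv.2).mono' (h.measurable_diffusionForm hu.1 hv.1).aestronglyMeasurable ?_
  filter_upwards [h.lower] with ω hω
  have h1 := two_mul_abs_diffusionForm_le h.measurableSet (fun x => hω.1.le.trans (hω.2 x))
    (u ω) (v ω)
  have h2 := abs_nonneg (diffusionForm (α ω) (u ω) (v ω))
  rw [Real.norm_eq_abs]
  exact (by linarith : |diffusionForm (α ω) (u ω) (v ω)| ≤
    diffusionForm (α ω) (u ω) (u ω) + diffusionForm (α ω) (v ω) (v ω))

theorem sub_mem_energySpace (h : EllipticityBound P α m K) {u v : Ω → H10 D}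
    (hu : u ∈ energySpace P α) (hv : v ∈ energySpace P α) : u - v ∈ energySpace P α := by
  refine ⟨hu.1.sub hv.1, ?_⟩
  simp only [Pi.sub_apply, diffusionForm_sub_self]
  exact (hu.2.sub ((h.integrable_diffusionForm hu hv).const_mul 2)).add hv.2

theorem ae_eq_of_isState (h : EllipticityBound P α m K) {φ : StrongDual ℝ (H10 D)}
    {u v : Ω → H10 D} (hu : IsState P α φ u) (hv : IsState P α φ v) : u =ᵐ[P] v := by
  have hw := h.sub_mem_energySpace hu.1 hv.1
  -- The difference of both equations, tested with `u - v`.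
  have e : ∫ ω, diffusionForm (α ω) ((u - v) ω) ((u - v) ω) ∂P = 0 := by
    rw [← sub_eq_zero.2 ((hu.2 _ hw).trans (hv.2 _ hw).symm),
      ← integral_sub (h.integrable_diffusionForm hu.1 hw) (h.integrable_diffusionForm hv.1 hw)]
    congr 1 with ω
    simp only [← inner_energyOp, Pi.sub_apply, map_sub, inner_sub_left]
  have hle : ∀ᵐ ω ∂P, m ω * ‖grad D ((u - v) ω)‖ ^ 2 ≤
      diffusionForm (α ω) ((u - v) ω) ((u - v) ω) := by
    filter_upwards [h.lower] with ω hω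
    exact mul_sq_norm_grad_le_diffusionForm h.measurableSet hω.2 _
  have hnn : 0 ≤ᵐ[P] fun ω => diffusionForm (α ω) ((u - v) ω) ((u - v) ω) := by
    filter_upwards [h.lower, hle] with ω h1 h2
    exact (mul_nonneg h1.1.le (sq_nonneg _)).trans h2
  filter_upwards [(integral_eq_zero_iff_of_nonneg_ae hnn hw.2).1 e, hle, h.lower] with ω h0 h1 h2
  rw [h0] at h1
  have h3 : ‖grad D ((u - v) ω)‖ ^ 2 ≤ 0 := nonpos_of_mul_nonpos_right h1 h2.1
  have h4 := (h.poincare ((u - v) ω)).trans (mul_nonpos_of_nonneg_of_nonpos h.pos.le h3)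
  have h5 : ‖(u - v) ω‖ = 0 := by
    have := le_antisymm h4 (sq_nonneg _)
    exact pow_eq_zero_iff two_ne_zero |>.1 this
  exact sub_eq_zero.1 (norm_eq_zero.1 h5)

theorem hasUniqueL2State [IsProbabilityMeasure P] (h : EllipticityBound P α m K)
    (φ : StrongDual ℝ (H10 D)) : HasUniqueL2State P α φ :=
  ⟨state α φ, h.isState_state φ, h.memLp_state φ,
    fun _ hy' => h.ae_eq_of_isState hy' (h.isState_state φ)⟩

/-- The state, as an element of `L²(Ω, H^1_0(D))`, depends linearly and boundedly on the
right-hand side. -/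
theorem exists_stateCLM (h : EllipticityBound P α m K) :
    ∃ S : StrongDual ℝ (H10 D) →L[ℝ] Lp (H10 D) 2 P, ∀ φ, S φ =ᵐ[P] state α φ := by
  let S : StrongDual ℝ (H10 D) →ₗ[ℝ] Lp (H10 D) 2 P :=
    { toFun := fun φ => (h.memLp_state φ).toLp _
      map_add' := fun φ ψ => by
        rw [← MemLp.toLp_add]
        congr 1
        ext1 ω
        simp [state]
      map_smul' := fun a φ => by
        rw [RingHom.id_apply, ← MemLp.toLp_const_smul]
        congr 1
        ext1 ω
        simp [state] }
  have hS (φ) : ‖S φ‖ ≤ K * (eLpNorm (fun ω => 1 / m ω) 2 P).toReal * ‖φ‖ := by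
    have h1 := eLpNorm_le_mul_eLpNorm_of_ae_le_mul (h.norm_state_le φ) 2
    have h2 := ENNReal.toReal_mono (ENNReal.mul_ne_top ENNReal.ofReal_ne_top h.memLp.2.ne) h1
    have h3 : 0 ≤ K * ‖φ‖ := mul_nonneg h.pos.le (norm_nonneg φ)
    rw [ENNReal.toReal_mul, ENNReal.toReal_ofReal h3] at h2
    change ‖(h.memLp_state φ).toLp _‖ ≤ _
    rw [Lp.norm_toLp]
    linarith
  have hcont : Continuous S := AddMonoidHomClass.continuous_of_bound S _ hS
  exact ⟨⟨S, hcont⟩, fun φ => MemLp.coeFn_toLp (h.memLp_state φ)⟩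

end EllipticityBound

theorem DiffusionAssumption.exists_ellipticityBound (hd : 1 ≤ d) (hDopen : IsOpen D)
    (hDne : D.Nonempty) (hDbdd : Bornology.IsBounded D) {P : Measure Ω} [IsProbabilityMeasure P]
    {α : Ω → C(closure D, ℝ)} {p : ℝ≥0∞} (hp : 2 ≤ p) (hα : DiffusionAssumption P α p) :
    ∃ K, EllipticityBound P α (fun ω => ⨅ x, α ω x) K := by
  obtain ⟨K, hK, hKu⟩ := exists_sq_norm_le_sq_norm_grad hd hDbdd
  have : CompactSpace (closure D) := isCompact_iff_compactSpace.1 hDbdd.isCompact_closure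
  have : Nonempty (closure D) := hDne.closure.to_subtype
  refine ⟨K, hα.measurable, hDopen.measurableSet, hK, hKu, ?_, hα.memLp_inv_min.mono_exponent hp⟩
  filter_upwards [hα.pos] with ω hω
  obtain ⟨x, -, hx⟩ :=
    isCompact_univ.exists_isMinOn Set.univ_nonempty (α ω).continuous.continuousOn
  have hle : ∀ z, α ω x ≤ α ω z := fun z => hx (Set.mem_univ z)
  exact ⟨(hω x).trans_le (le_ciInf hle), ciInf_le ⟨α ω x, Set.forall_mem_range.2 hle⟩⟩

/-! ### Minimizers of quadratic functionals -/

/-- A continuous uniformly convex functional that is bounded below on a Banach space has exactly one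
minimizer. -/
theorem existsUnique_forall_le_of_midpoint_le {U : Type*} [NormedAddCommGroup U]
    [NormedSpace ℝ U] [CompleteSpace U] {J : U → ℝ} (hJ : Continuous J)
    (hbdd : BddBelow (Set.range J)) {κ : ℝ} (hκ : 0 < κ)
    (hmid : ∀ u v, J ((1 / 2 : ℝ) • (u + v)) ≤ (J u + J v) / 2 - κ * ‖u - v‖ ^ 2) :
    ∃! u, ∀ v, J u ≤ J v := by
  have hinf : ∀ u, ⨅ v, J v ≤ J u := ciInf_le hbdd
  choose u hu using fun n : ℕ => exists_lt_of_ciInf_lt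
    (lt_add_of_pos_right (⨅ v, J v) (Nat.one_div_pos_of_nat (α := ℝ) (n := n)))
  have hdist : ∀ n k N : ℕ, N ≤ n → N ≤ k →
      dist (u n) (u k) ≤ √(κ⁻¹ * (1 / ((N : ℝ) + 1))) := by
    intro n k N hn hk
    refine Real.le_sqrt_of_sq_le ?_
    rw [dist_eq_norm, inv_mul_eq_div, le_div_iff₀ hκ]
    -- The midpoint value is at least the infimum, so the defect is at most the mean of the excesses.
    have h1 := hmid (u n) (u k)
    have h2 := hinf ((1 / 2 : ℝ) • (u n + u k))
    have h3 := (hu n).le.trans (add_le_add_right (Nat.one_div_le_one_div (α := ℝ) hn) _)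
    have h4 := (hu k).le.trans (add_le_add_right (Nat.one_div_le_one_div (α := ℝ) hk) _)
    linarith
  have hb : Filter.Tendsto (fun N : ℕ => √(κ⁻¹ * (1 / ((N : ℝ) + 1)))) Filter.atTop (nhds 0) := by
    have := (Real.continuous_sqrt.tendsto _).comp
      ((tendsto_one_div_add_atTop_nhds_zero_nat (𝕜 := ℝ)).const_mul κ⁻¹)
    simpa [Function.comp_def] using this
  obtain ⟨u₀, hu₀⟩ := cauchySeq_tendsto_of_complete (cauchySeq_of_le_tendsto_0 _ hdist hb)
  have hle : J u₀ ≤ ⨅ v, J v := by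
    have h1 := (hJ.tendsto u₀).comp hu₀
    have h2 := (tendsto_one_div_add_atTop_nhds_zero_nat (𝕜 := ℝ)).const_add (⨅ v, J v)
    rw [add_zero] at h2
    exact le_of_tendsto_of_tendsto' h1 h2 fun n => (hu n).le
  refine ⟨u₀, fun v => hle.trans (hinf v), fun v hv => ?_⟩
  have h1 := hmid v u₀
  have h2 := hv ((1 / 2 : ℝ) • (v + u₀))
  have h3 := hv u₀
  have h4 := hle.trans (hinf v)
  have h5 : κ * ‖v - u₀‖ ^ 2 ≤ 0 := by linarith
  have h6 : ‖v - u₀‖ ^ 2 = 0 := le_antisymm (nonpos_of_mul_nonpos_right h5 hκ) (sq_nonneg _)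
  exact sub_eq_zero.1 (norm_eq_zero.1 (pow_eq_zero_iff two_ne_zero |>.1 h6))

theorem sq_norm_midpoint {E : Type*} [NormedAddCommGroup E] [InnerProductSpace ℝ E] (a b : E) :
    ‖(1 / 2 : ℝ) • (a + b)‖ ^ 2 = (‖a‖ ^ 2 + ‖b‖ ^ 2) / 2 - ‖a - b‖ ^ 2 / 4 := by
  have := parallelogram_law_with_norm ℝ a b
  rw [norm_smul, Real.norm_of_nonneg (by norm_num)]
  nlinarith

/-- A quadratic functional with a bounded-below regularization `Φ` has exactly one minimizer. The
regularization makes it uniformly convex. -/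
theorem existsUnique_forall_tracking_le {U V W : Type*} [NormedAddCommGroup U]
    [NormedSpace ℝ U] [CompleteSpace U] [NormedAddCommGroup V] [InnerProductSpace ℝ V]
    [NormedAddCommGroup W] [InnerProductSpace ℝ W] (T : U →L[ℝ] V) (Q : V →L[ℝ] V)
    (Φ : U →L[ℝ] W) (y₀ k : V) {γ β c : ℝ} (hγ : 0 ≤ γ) (hβ : 0 < β) (hc : 0 < c)
    (hΦ : ∀ u, c * ‖u‖ ^ 2 ≤ ‖Φ u‖ ^ 2) :
    ∃! u, ∀ v, 1 / 2 * ‖y₀ + T u - k‖ ^ 2 + γ / 2 * ‖Q (y₀ + T u)‖ ^ 2 + β / 2 * ‖Φ u‖ ^ 2 ≤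
      1 / 2 * ‖y₀ + T v - k‖ ^ 2 + γ / 2 * ‖Q (y₀ + T v)‖ ^ 2 + β / 2 * ‖Φ v‖ ^ 2 := by
  refine existsUnique_forall_le_of_midpoint_le (κ := β * c / 8)
    (J := fun u => 1 / 2 * ‖y₀ + T u - k‖ ^ 2 + γ / 2 * ‖Q (y₀ + T u)‖ ^ 2 + β / 2 * ‖Φ u‖ ^ 2)
    (by fun_prop) ⟨0, ?_⟩ (by positivity) fun u v => ?_
  · rintro _ ⟨u, rfl⟩
    positivity
  have e1 : y₀ + T ((1 / 2 : ℝ) • (u + v)) = (1 / 2 : ℝ) • ((y₀ + T u) + (y₀ + T v)) := by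
    rw [map_smul, map_add]
    module
  have e2 : y₀ + T ((1 / 2 : ℝ) • (u + v)) - k =
      (1 / 2 : ℝ) • ((y₀ + T u - k) + (y₀ + T v - k)) := by
    rw [e1]
    module
  have e3 : ‖Φ u - Φ v‖ ^ 2 ≥ c * ‖u - v‖ ^ 2 := by simpa using hΦ (u - v)
  have e4 : Φ ((1 / 2 : ℝ) • (u + v)) = (1 / 2 : ℝ) • (Φ u + Φ v) := by rw [map_smul, map_add]
  rw [e2, e1, e4, map_smul Q, map_add Q, sq_norm_midpoint, sq_norm_midpoint, sq_norm_midpoint]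
  have h1 := mul_nonneg hγ (sq_nonneg ‖Q (y₀ + T u) - Q (y₀ + T v)‖)
  have h2 := sq_nonneg ‖y₀ + T u - k - (y₀ + T v - k)‖
  have h3 := mul_le_mul_of_nonneg_left e3 hβ.le
  linarith

/-- The expectation is bounded on `L²(Ω, E)`, being the adjoint of the embedding of the
constants. -/
theorem exists_expectationCLM {Ω E : Type*} [MeasurableSpace Ω] (P : Measure Ω)
    [IsProbabilityMeasure P] [NormedAddCommGroup E] [InnerProductSpace ℝ E] [CompleteSpace E] :
    ∃ M : Lp E 2 P →L[ℝ] E, ∀ Y, M Y = ∫ ω, Y ω ∂P := by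
  refine ⟨ContinuousLinearMap.adjoint (Lp.constL 2 P ℝ), fun Y => ext_inner_left ℝ fun x => ?_⟩
  rw [ContinuousLinearMap.adjoint_inner_right, L2.inner_def,
    ← integral_inner ((Lp.memLp Y).integrable one_le_two)]
  refine integral_congr_ae ?_
  filter_upwards [Lp.coeFn_const 2 P x] with ω hω
  rw [Lp.constL_apply, hω]
  rfl

/-! ### The optimal control problem -/

theorem objective_congr_ae {P : Measure Ω} (γ β : ℝ) (yd : L2 D) {y y' : Ω → H10 D}
    (h : y =ᵐ[P] y') (a : ℝ) : objective P γ β yd y a = objective P γ β yd y' a := by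
  have hz (z : L2 D) : ∫ ω, ‖toL2 D (y ω) - z‖ ^ 2 ∂P = ∫ ω, ‖toL2 D (y' ω) - z‖ ^ 2 ∂P :=
    integral_congr_ae (h.mono fun ω hω => by simp [hω])
  have hE : ∫ ω, toL2 D (y ω) ∂P = ∫ ω, toL2 D (y' ω) ∂P :=
    integral_congr_ae (h.mono fun ω hω => by simp [hω])
  unfold objective
  rw [hE, hz, hz]

/-- The objective in terms of norms of `L²(Ω, L²(D))`. -/
theorem objective_eq_norm_sq {P : Measure Ω} [IsProbabilityMeasure P] (γ β : ℝ) (yd : L2 D)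
    {y : Ω → H10 D} {Y : Lp (L2 D) 2 P} (hY : Y =ᵐ[P] fun ω => toL2 D (y ω)) (a : ℝ) :
    objective P γ β yd y a = 1 / 2 * ‖Y - Lp.constL 2 P ℝ yd‖ ^ 2
      + γ / 2 * ‖Y - Lp.constL 2 P ℝ (∫ ω, Y ω ∂P)‖ ^ 2 + β / 2 * a := by
  have h (z : L2 D) : ‖Y - Lp.constL 2 P ℝ z‖ ^ 2 = ∫ ω, ‖toL2 D (y ω) - z‖ ^ 2 ∂P := by
    refine (sq_norm_L2_eq_integral _).trans (integral_congr_ae ?_)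
    filter_upwards [hY, Lp.coeFn_sub Y (Lp.constL 2 P ℝ z), Lp.coeFn_const 2 P z] with ω h1 h2 h3
    rw [h2, Pi.sub_apply, h1, Lp.constL_apply, h3]
    rfl
  rw [h, h, integral_congr_ae hY]
  rfl

/-- Unique solvability for a general control space `U`, whose norm is given up to equivalence by
`‖Φ u‖`. -/
theorem EllipticityBound.existsUnique_isOptimalControl [CompactSpace (closure D)] {P : Measure Ω}
    [IsProbabilityMeasure P] {α : Ω → C(closure D, ℝ)} {m : Ω → ℝ} {K : ℝ}
    (h : EllipticityBound P α m K) {U W : Type*} [NormedAddCommGroup U] [NormedSpace ℝ U]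
    [CompleteSpace U] [NormedAddCommGroup W] [InnerProductSpace ℝ W]
    (Λ : U →L[ℝ] StrongDual ℝ (H10 D)) (Φ : U →L[ℝ] W) {c : ℝ} (hc : 0 < c)
    (hΦ : ∀ u, c * ‖u‖ ^ 2 ≤ ‖Φ u‖ ^ 2) (f : StrongDual ℝ (H10 D)) (yd : L2 D) {γ β : ℝ}
    (hγ : 0 ≤ γ) (hβ : 0 < β) :
    ∃! u, IsOptimalControl P α γ β yd f Λ (fun u => ‖Φ u‖ ^ 2) u := by
  obtain ⟨S, hS⟩ := h.exists_stateCLM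
  obtain ⟨M, hM⟩ := exists_expectationCLM (E := L2 D) P
  let T : StrongDual ℝ (H10 D) →L[ℝ] Lp (L2 D) 2 P := ((toL2 D).compLpL 2 P).comp S
  have hT (φ) : T φ =ᵐ[P] fun ω => toL2 D (state α φ ω) := by
    filter_upwards [ContinuousLinearMap.coeFn_compLpL (p := 2) (toL2 D) (S φ), hS φ] with ω h1 h2
    exact h1.trans (by rw [h2])
  let Q : Lp (L2 D) 2 P →L[ℝ] Lp (L2 D) 2 P :=
    ContinuousLinearMap.id ℝ (Lp (L2 D) 2 P) - (Lp.constL 2 P ℝ).comp M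
  have hobj (u : U) {y : Ω → H10 D} (hy : IsState P α (f + Λ u) y) :
      objective P γ β yd y (‖Φ u‖ ^ 2) =
        1 / 2 * ‖T f + (T.comp Λ) u - Lp.constL 2 P ℝ yd‖ ^ 2
          + γ / 2 * ‖Q (T f + (T.comp Λ) u)‖ ^ 2 + β / 2 * ‖Φ u‖ ^ 2 := by
    rw [objective_congr_ae γ β yd (h.ae_eq_of_isState hy (h.isState_state _)),
      objective_eq_norm_sq γ β yd (hT (f + Λ u)), ← hM, map_add]
    rfl
  have huniq := existsUnique_forall_tracking_le (T.comp Λ) Q Φ (T f) (Lp.constL 2 P ℝ yd)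
    hγ hβ hc hΦ
  refine (existsUnique_congr fun u => ?_).1 huniq
  constructor
  · intro hu
    refine ⟨state α (f + Λ u), h.isState_state _, fun u' y' hy' => ?_⟩
    rw [hobj u (h.isState_state _), hobj u' hy']
    exact hu u'
  · rintro ⟨y, hy, hu⟩ v
    have := hu v _ (h.isState_state _)
    rwa [hobj u hy, hobj v (h.isState_state _)] at this

end RobustOCP

end

theorem lemma3p3 {d : ℕ} (hd : 1 ≤ d) {D : Set (RobustOCP.Rd d)} (hDopen : IsOpen D)
    (hDconn : IsConnected D) (hDbdd : Bornology.IsBounded D)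
    {Ω : Type*} [MeasurableSpace Ω] (P : Measure Ω) [IsProbabilityMeasure P]
    (α : Ω → C(closure D, ℝ)) (p : ℝ≥0∞) (hp : 2 ≤ p)
    (hα : RobustOCP.DiffusionAssumption P α p)
    (f : StrongDual ℝ (RobustOCP.H10 D)) (yd : RobustOCP.L2 D)
    (γ β : ℝ) (hγ : 0 ≤ γ) (hβ : 0 < β) :
    -- control space `U = L²(D)`
    ((∀ u : RobustOCP.L2 D, RobustOCP.HasUniqueL2State P α (f + RobustOCP.rieszL2 D u)) ∧
      ∃! u : RobustOCP.L2 D, RobustOCP.IsOptimalControl P α γ β yd f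
        (RobustOCP.rieszL2 D) (fun u => ‖u‖ ^ 2) u) ∧
    -- control space `U = Y`, normed by `‖∇u‖_{L²(D)}`
    ((∀ u : RobustOCP.H10 D, RobustOCP.HasUniqueL2State P α (f + RobustOCP.rieszH10 D u)) ∧
      ∃! u : RobustOCP.H10 D, RobustOCP.IsOptimalControl P α γ β yd f
        (RobustOCP.rieszH10 D) (fun u => ‖RobustOCP.grad D u‖ ^ 2) u) := by
  have : CompactSpace (closure D) := isCompact_iff_compactSpace.1 hDbdd.isCompact_closure
  obtain ⟨K, h⟩ := hα.exists_ellipticityBound hd hDopen hDconn.nonempty hDbdd hp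
  refine ⟨⟨fun u => h.hasUniqueL2State _, ?_⟩, fun u => h.hasUniqueL2State _, ?_⟩
  · exact h.existsUnique_isOptimalControl
      ((ContinuousLinearMap.precomp ℝ (RobustOCP.toL2 D)).comp (innerSL ℝ))
      (ContinuousLinearMap.id ℝ (RobustOCP.L2 D)) one_pos (fun u => (one_mul _).le) f yd hγ hβ
  · refine h.existsUnique_isOptimalControl
      ((ContinuousLinearMap.precomp ℝ (RobustOCP.grad D)).comp
        ((innerSL ℝ).comp (RobustOCP.grad D)))
      (RobustOCP.grad D) (inv_pos.2 h.pos) (fun u => ?_) f yd hγ hβ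
    rw [inv_mul_le_iff₀ h.pos]
    exact h.poincare u
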